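/- Let $\mathbb D$ be the open unit disk and let $\mathcal F=\{F_t\}_{t\ge 0}$ be a one-parameter continuous semigroup of holomorphic self-maps of $\mathbb D$ (jointly continuous in $(t,z)$, $F_{t+s}=F_t\circ F_s$, $F_0=\mathrm{id}$) generated by a holomorphic $f:\mathbb D\to\mathbb C$, i.e. $f(z)=\lim_{t\to0^+}(F_t(z)-z)/t$. Assume $f(z_0)=0$ for some $z_0\in\mathbb D$ and that $\lambda:=-f'(z_0)$ satisfies $\operatorname{Re}\lambda>0$. Then $\mathcal F$ has a Koenigs function: a univalent holomorphic $h:\mathbb D\to\mathbb C$ with $h(z_0)=0$, $h'(z_0)=1$ and $h(F_t(z))=e^{-\lambda t}h(z)$ for all $t\ge0$, $z\in\mathbb D$. Let $h$ be the Koenigs function. Let $\mathcal A$ be a complex unital Banach algebra with $\|1\|=1$. A semicocycle over $\mathcal F$ is a family of holomorphic maps $\Gamma_t:\mathbb D\to\mathcal A$, $t\ge 0$, jointly continuous in $(t,z)$, with $\Gamma_t(F_s(z))\Gamma_s(z)=\Gamma_{t+s}(z)$ and $\Gamma_0(z)=1$. It is generated by a holomorphic $B:\mathbb D\to\mathcal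 A$ if $\frac{d}{dt}\Gamma_t(z)=B(F_t(z))\Gamma_t(z)$ for all $t\ge 0$, $z\in\mathbb D$. It is linearizable if $\Gamma_t(z)=M(F_t(z))^{-1}e^{tC}M(z)$ for some $C\in\mathcal A$ and some holomorphic $M$ on $\mathbb D$ with invertible values in $\mathcal A$. Let $B_0\in\mathcal A$, put $\operatorname{ad}_{B_0}(a)=aB_0-B_0a$, let $\sigma$ denote the spectrum, and let $k\ge1$ be an integer. (a) If $A\in\mathcal A$ is not in the range of $k\lambda-\operatorname{ad}_{B_0}$, then $B(z)=B_0+h(z)^kA$ satisfies $B(z_0)=B_0$ and generates a semicocycle over $\mathcal F$, and this semicocycle is not linearizable. (b) If $\mathcal A$ is finite-dimensional and $k\lambda\in\sigma(\operatorname{ad}_{B_0})$, then an $A$ as in (a) exists. Hence, whenever the condition $\sigma(\operatorname{ad}_{B_0})\cap\{\lambda,2\lambda,3\lambda,\dots\}=\emptyset$ fails, there is a generator $B$ with $B(z_0)=B_0$ whose semicocycle is not linearizable. (c) If $\mathcal A$ is isomorphic as an algebra to a full matrix algebra $M_n(\mathbb C)$ and $k\lambda\in\sigma(B_0)-\sigma(B_0)$,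 then an $A$ as in (a) exists. Hence, whenever the condition $(\sigma(B_0)-\sigma(B_0))\cap\{\lambda,2\lambda,3\lambda,\dots\}=\emptyset$ fails, there is a generator $B$ with $B(z_0)=B_0$ whose semicocycle is not linearizable. (d) In particular, non-linearizable $M_2(\mathbb C)$-valued semicocycles exist: over the semigroup $F_t(z)=e^{-t}z$, and with the operator norm on $M_2(\mathbb C)$, the family $\Gamma_t(z)=\begin{pmatrix}e^t& zte^t\\0&e^{2t}\end{pmatrix}$ is a semicocycle generated by $B(z)=\begin{pmatrix}1&z\\0&2\end{pmatrix}$, and it is not linearizable. -/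

import Mathlib

open Set Filter Topology
open scoped Pointwise Matrix.Norms.L2Operator

universe u

noncomputable section

/-- The open unit disk of the complex plane. -/
abbrev unitDisk : Set ℂ := Metric.ball (0 : ℂ) 1

/-- A one-parameter continuous semigroup `(F t)`, `t ≥ 0`, of holomorphic self-mappings of the
open unit disk. (Values for `t < 0` or off the disk are irrelevant.) -/
structure IsHolSemigroup (F : ℝ → ℂ → ℂ) : Prop where
  holomorphic : ∀ t, 0 ≤ t → DifferentiableOn ℂ (F t) unitDisk
  mapsTo : ∀ t, 0 ≤ t → MapsTo (F t) unitDisk unitDisk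
  continuousOn : ContinuousOn (fun p : ℝ × ℂ => F p.1 p.2) (Ici 0 ×ˢ unitDisk)
  add : ∀ t s, 0 ≤ t → 0 ≤ s → ∀ z ∈ unitDisk, F (t + s) z = F t (F s z)
  zero : ∀ z ∈ unitDisk, F 0 z = z

/-- `f` is the (holomorphic) infinitesimal generator of the semigroup `F`. -/
structure IsSemigroupGenerator (F : ℝ → ℂ → ℂ) (f : ℂ → ℂ) : Prop where
  holomorphic : DifferentiableOn ℂ f unitDisk
  tendsto : ∀ z ∈ unitDisk,
    Tendsto (fun t : ℝ => (F t z - z) / (t : ℂ)) (𝓝[>] 0) (𝓝 (f z))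

/-- `h` is the normalized Koenigs function of the semigroup `F` at the interior fixed point `z₀`:
it is univalent on the disk and linearizes `F`. -/
structure IsKoenigsFunction (F : ℝ → ℂ → ℂ) (z₀ lam : ℂ) (h : ℂ → ℂ) : Prop where
  holomorphic : DifferentiableOn ℂ h unitDisk
  injOn : InjOn h unitDisk
  map_fixed : h z₀ = 0
  deriv_fixed : deriv h z₀ = 1
  schroeder : ∀ t : ℝ, 0 ≤ t → ∀ z ∈ unitDisk,
    h (F t z) = Complex.exp (-lam * (t : ℂ)) * h z

section Semicocycles

variable {𝒜 : Type u} [NormedRing 𝒜] [NormedAlgebra ℂ 𝒜]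

/-- `(Γ t)`, `t ≥ 0`, is a (holomorphic, jointly continuous) semicocycle over the semigroup `F`. -/
structure IsSemicocycle (F : ℝ → ℂ → ℂ) (Γ : ℝ → ℂ → 𝒜) : Prop where
  holomorphic : ∀ t, 0 ≤ t → DifferentiableOn ℂ (Γ t) unitDisk
  continuousOn : ContinuousOn (fun p : ℝ × ℂ => Γ p.1 p.2) (Ici 0 ×ˢ unitDisk)
  chain : ∀ t s, 0 ≤ t → 0 ≤ s → ∀ z ∈ unitDisk, Γ t (F s z) * Γ s z = Γ (t + s) z
  zero : ∀ z ∈ unitDisk, Γ 0 z = 1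

/-- `Γ` solves the evolution problem `dΓ_t(z)/dt = B(F_t(z)) Γ_t(z)`, `Γ_0(z) = 1`, `t ≥ 0`
(with a one-sided derivative at `t = 0`); that is, `Γ` is generated by `B`. -/
def SemicocycleGeneratedBy (F : ℝ → ℂ → ℂ) (Γ : ℝ → ℂ → 𝒜) (B : ℂ → 𝒜) : Prop :=
  ∀ z ∈ unitDisk, Γ 0 z = 1 ∧ ∀ t : ℝ, 0 ≤ t →
    HasDerivWithinAt (fun s : ℝ => Γ s z) (B (F t z) * Γ t z) (Ici 0) t

/-- `Γ_t(z) = M(F_t(z))⁻¹ exp(t C) M(z)` for some `C` and some holomorphic `M` on the disk with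
invertible values. -/
def IsLinearizable (F : ℝ → ℂ → ℂ) (Γ : ℝ → ℂ → 𝒜) : Prop :=
  ∃ (M : ℂ → 𝒜) (C : 𝒜), DifferentiableOn ℂ M unitDisk ∧ (∀ z ∈ unitDisk, IsUnit (M z)) ∧
    ∀ t : ℝ, 0 ≤ t → ∀ z ∈ unitDisk,
      Γ t z = Ring.inverse (M (F t z)) * NormedSpace.exp ((t : ℂ) • C) * M z

/-- `B` is holomorphic on the disk, it generates a semicocycle over `F`, and the semicocycle
generated by `B` is not linearizable. -/
def GeneratesNonlinearizable (F : ℝ → ℂ → ℂ) (B : ℂ → 𝒜) : Prop :=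
  DifferentiableOn ℂ B unitDisk ∧
  (∃ Γ : ℝ → ℂ → 𝒜, IsSemicocycle F Γ ∧ SemicocycleGeneratedBy F Γ B) ∧
  ∀ Γ : ℝ → ℂ → 𝒜, IsSemicocycle F Γ → SemicocycleGeneratedBy F Γ B → ¬ IsLinearizable F Γ

/-- The bounded operator `a ↦ a B₀ - B₀ a`. -/
def adOp (B₀ : 𝒜) : 𝒜 →L[ℂ] 𝒜 :=
  (ContinuousLinearMap.mul ℂ 𝒜).flip B₀ - ContinuousLinearMap.mul ℂ 𝒜 B₀

theorem adOp_apply (B₀ a : 𝒜) : adOp B₀ a = a * B₀ - B₀ * a := rfl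

end Semicocycles

end

/-!
In the coordinate `w = h z` the semigroup is the linear flow `w ↦ exp (-λ t) w`. If `M` linearizes
the semicocycle generated by `B₀ + h ^ k A`, then `N = M ∘ h⁻¹` satisfies near `0`
`N (B₀ + w ^ k A) = λ w N' + C N`. Comparing Taylor coefficients of order `0` and `k` gives
`N₀ B₀ = C N₀` and `N_k B₀ + N₀ A = k λ N_k + C N_k`, so `A = (k λ - ad B₀) (N₀⁻¹ N_k)` would lie in
the range. In finite dimension `k λ - ad B₀` fails to be onto as soon as `k λ` is in the spectrum of
`ad B₀`, and for matrices that spectrum contains all differences of eigenvalues of `B₀`.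

The Koenigs function is the solution of `h' f = -λ h` with `h' z₀ = 1`. All orbits tend to `z₀`,
where `h` is injective, and the Schröder equation carries injectivity back along the orbits.
Semicocycles with a prescribed generator are obtained by summing the Dyson series of iterated
integrals.
-/

theorem isOpen_unitDisk : IsOpen unitDisk := Metric.isOpen_ball

section Orbits

variable {F : ℝ → ℂ → ℂ} {f : ℂ → ℂ} {z : ℂ} {T : ℝ}

theorem IsHolSemigroup.continuousOn_orbit (hF : IsHolSemigroup F) (hz : z ∈ unitDisk) :
    ContinuousOn (fun t => F t z) (Ici 0) :=
  hF.continuousOn.comp (f := fun t : ℝ => (t, z)) (by fun_prop) fun _ ht => ⟨ht, hz⟩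

theorem IsHolSemigroup.hasDerivWithinAt_zero (hF : IsHolSemigroup F)
    (hf : IsSemigroupGenerator F f) (hz : z ∈ unitDisk) :
    HasDerivWithinAt (fun t => F t z) (f z) (Ici 0) 0 := by
  rw [hasDerivWithinAt_iff_tendsto_slope, Ici_sdiff_left]
  refine (hf.tendsto z hz).congr fun t => ?_
  rw [slope_def_module, hF.zero z hz, sub_zero, Complex.real_smul, Complex.ofReal_inv,
    div_eq_inv_mul]

theorem IsHolSemigroup.hasDerivWithinAt_right (hF : IsHolSemigroup F)
    (hf : IsSemigroupGenerator F f) (hz : z ∈ unitDisk) {t : ℝ} (ht : 0 ≤ t) :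
    HasDerivWithinAt (fun t => F t z) (f (F t z)) (Ici t) t := by
  have hstart : HasDerivWithinAt (fun s => F s (F t z)) (f (F t z)) (Ici 0) (t - t) := by
    rw [sub_self]
    exact hF.hasDerivWithinAt_zero hf (hF.mapsTo t ht hz)
  have hshift : HasDerivWithinAt (fun s => F (s - t) (F t z)) (f (F t z)) (Ici t) t := by
    have hsub : HasDerivWithinAt (fun s : ℝ => s - t) 1 (Ici t) t :=
      ((hasDerivAt_id t).sub_const t).hasDerivWithinAt
    simpa [Function.comp_def] using hstart.scomp (h := fun s => s - t) t hsub
      fun s hs => mem_Ici.2 (sub_nonneg.2 hs)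
  refine hshift.congr_of_mem (fun s hs => ?_) self_mem_Ici
  rw [← hF.add (s - t) t (sub_nonneg.2 hs) ht z hz, sub_add_cancel]

theorem exists_lipschitzOnWith_closedBall (hf : DifferentiableOn ℂ f unitDisk) {r : ℝ}
    (hr : r < 1) : ∃ K, LipschitzOnWith K f (Metric.closedBall 0 r) := by
  have hsub : Metric.closedBall (0 : ℂ) r ⊆ unitDisk := Metric.closedBall_subset_ball hr
  obtain ⟨C, hC⟩ := (isCompact_closedBall (0 : ℂ) r).exists_bound_of_continuousOn
    ((hf.deriv isOpen_unitDisk).continuousOn.mono hsub)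
  refine ⟨C.toNNReal, (convex_closedBall (0 : ℂ) r).lipschitzOnWith_of_nnnorm_deriv_le
    (fun x hx => hf.differentiableAt (isOpen_unitDisk.mem_nhds (hsub hx))) fun x hx => ?_⟩
  rw [← NNReal.coe_le_coe]
  exact (hC x hx).trans (Real.le_coe_toNNReal C)

theorem IsHolSemigroup.exists_orbit_subset_closedBall (hF : IsHolSemigroup F) (hz : z ∈ unitDisk)
    (hT : 0 ≤ T) : ∃ r < 1, ∀ t ∈ Icc 0 T, F t z ∈ Metric.closedBall (0 : ℂ) r := by
  obtain ⟨s, hs, hmax⟩ := (isCompact_Icc (a := 0) (b := T)).exists_isMaxOn ⟨0, le_rfl, hT⟩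
    (((hF.continuousOn_orbit hz).mono Icc_subset_Ici_self).norm)
  exact ⟨‖F s z‖, mem_ball_zero_iff.1 (hF.mapsTo s hs.1 hz),
    fun t ht => mem_closedBall_zero_iff.2 (hmax ht)⟩

theorem IsHolSemigroup.fixed_of_generator_eq_zero (hF : IsHolSemigroup F)
    (hf : IsSemigroupGenerator F f) (hz : z ∈ unitDisk) (hfz : f z = 0) (hT : 0 ≤ T) :
    F T z = z := by
  obtain ⟨r, hr, hzr⟩ := hF.exists_orbit_subset_closedBall hz hT
  obtain ⟨K, hK⟩ := exists_lipschitzOnWith_closedBall hf.holomorphic hr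
  have hz_mem : z ∈ Metric.closedBall (0 : ℂ) r := hF.zero z hz ▸ hzr 0 ⟨le_rfl, hT⟩
  exact ODE_solution_unique_of_mem_Icc_right (v := fun _ => f) (K := K)
    (s := fun _ => Metric.closedBall 0 r) (f := fun t => F t z) (g := fun _ => z)
    (fun _ _ => hK) ((hF.continuousOn_orbit hz).mono Icc_subset_Ici_self)
    (fun t ht => hF.hasDerivWithinAt_right hf hz ht.1)
    (fun t ht => hzr t ⟨ht.1, ht.2.le⟩) continuousOn_const
    (fun t _ => hfz.symm ▸ hasDerivWithinAt_const t (Ici t) z) (fun _ _ => hz_mem)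
    (hF.zero z hz) ⟨hT, le_rfl⟩

end Orbits

section DiskInvolution

open ComplexConjugate

/-- The involutive automorphism of the disk that exchanges `a` and `0`. Conjugation by it reduces
self-maps that fix `a` to those that fix `0`, to which the Schwarz lemma applies. -/
noncomputable def diskInvolution (a z : ℂ) : ℂ := (a - z) / (1 - conj a * z)

theorem diskInvolution_self (a : ℂ) : diskInvolution a a = 0 := by
  rw [diskInvolution, sub_self, zero_div]

theorem diskInvolution_zero (a : ℂ) : diskInvolution a 0 = a := by
  rw [diskInvolution, sub_zero, mul_zero, sub_zero, div_one]

theorem normSq_lt_one_iff_mem_unitDisk {z : ℂ} : Complex.normSq z < 1 ↔ z ∈ unitDisk := by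
  rw [Complex.normSq_eq_norm_sq, mem_ball_zero_iff, sq_lt_one_iff₀ (norm_nonneg z)]

variable {G : ℂ → ℂ} {a b z : ℂ}

theorem one_sub_conj_mul_ne_zero (ha : a ∈ unitDisk) (hz : z ∈ unitDisk) :
    1 - conj a * z ≠ 0 := by
  rw [mem_ball_zero_iff] at ha hz
  have hlt : ‖conj a * z‖ < 1 := by
    rw [norm_mul, RCLike.norm_conj]
    exact mul_lt_one_of_nonneg_of_lt_one_left (norm_nonneg a) ha hz.le
  exact sub_ne_zero.2 fun h => by rw [← h, norm_one] at hlt; exact lt_irrefl _ hlt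

theorem one_sub_normSq_diskInvolution (ha : a ∈ unitDisk) (hz : z ∈ unitDisk) :
    (1 - Complex.normSq (diskInvolution a z)) * Complex.normSq (1 - conj a * z) =
      (1 - Complex.normSq a) * (1 - Complex.normSq z) := by
  have hden := Complex.normSq_pos.2 (one_sub_conj_mul_ne_zero ha hz)
  rw [diskInvolution, map_div₀, sub_mul, div_mul_cancel₀ _ hden.ne']
  simp only [Complex.normSq_apply, Complex.sub_re, Complex.sub_im, Complex.mul_re, Complex.mul_im,
    Complex.conj_re, Complex.conj_im, Complex.one_re, Complex.one_im]
  ring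

theorem mapsTo_diskInvolution (ha : a ∈ unitDisk) :
    MapsTo (diskInvolution a) unitDisk unitDisk := by
  intro z hz
  have hden := Complex.normSq_pos.2 (one_sub_conj_mul_ne_zero ha hz)
  have hpos : 0 < (1 - Complex.normSq a) * (1 - Complex.normSq z) :=
    mul_pos (sub_pos.2 (normSq_lt_one_iff_mem_unitDisk.2 ha))
      (sub_pos.2 (normSq_lt_one_iff_mem_unitDisk.2 hz))
  rw [← one_sub_normSq_diskInvolution ha hz] at hpos
  exact normSq_lt_one_iff_mem_unitDisk.1 (sub_pos.1 (pos_of_mul_pos_left hpos hden.le))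

theorem diskInvolution_diskInvolution (ha : a ∈ unitDisk) (hz : z ∈ unitDisk) :
    diskInvolution a (diskInvolution a z) = z := by
  have hmul : diskInvolution a z * (1 - conj a * z) = a - z :=
    div_mul_cancel₀ _ (one_sub_conj_mul_ne_zero ha hz)
  rw [diskInvolution, div_eq_iff (one_sub_conj_mul_ne_zero ha (mapsTo_diskInvolution ha hz))]
  linear_combination -hmul

theorem differentiableOn_diskInvolution (ha : a ∈ unitDisk) :
    DifferentiableOn ℂ (diskInvolution a) unitDisk :=
  (differentiableOn_id.const_sub a).div ((differentiableOn_id.const_mul (conj a)).const_sub 1)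
    fun _ hz => one_sub_conj_mul_ne_zero ha hz

theorem differentiableOn_conj_diskInvolution (ha : a ∈ unitDisk)
    (hG : DifferentiableOn ℂ G unitDisk) (hmaps : MapsTo G unitDisk unitDisk) :
    DifferentiableOn ℂ (diskInvolution a ∘ G ∘ diskInvolution a) unitDisk :=
  (differentiableOn_diskInvolution ha).comp
    (hG.comp (differentiableOn_diskInvolution ha) (mapsTo_diskInvolution ha))
    (hmaps.comp (mapsTo_diskInvolution ha))

theorem mapsTo_conj_diskInvolution (ha : a ∈ unitDisk) (hmaps : MapsTo G unitDisk unitDisk) :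
    MapsTo (diskInvolution a ∘ G ∘ diskInvolution a) unitDisk unitDisk :=
  (mapsTo_diskInvolution ha).comp (hmaps.comp (mapsTo_diskInvolution ha))

theorem conj_diskInvolution_zero (hfix : G a = a) :
    (diskInvolution a ∘ G ∘ diskInvolution a) 0 = 0 := by
  simp only [Function.comp_apply, diskInvolution_zero, hfix, diskInvolution_self]

theorem conj_diskInvolution_diskInvolution (ha : a ∈ unitDisk) (hz : z ∈ unitDisk) :
    (diskInvolution a ∘ G ∘ diskInvolution a) (diskInvolution a z) = diskInvolution a (G z) := by
  simp only [Function.comp_apply, diskInvolution_diskInvolution ha hz]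

theorem norm_diskInvolution_le_of_fixed (ha : a ∈ unitDisk) (hG : DifferentiableOn ℂ G unitDisk)
    (hmaps : MapsTo G unitDisk unitDisk) (hfix : G a = a) (hz : z ∈ unitDisk) :
    ‖diskInvolution a (G z)‖ ≤ ‖diskInvolution a z‖ := by
  rw [← conj_diskInvolution_diskInvolution ha hz]
  exact Complex.norm_le_norm_of_mapsTo_ball (differentiableOn_conj_diskInvolution ha hG hmaps)
    ((mapsTo_conj_diskInvolution ha hmaps).mono_right Metric.ball_subset_closedBall)
    (conj_diskInvolution_zero hfix) (mem_ball_zero_iff.1 (mapsTo_diskInvolution ha hz))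

theorem eqOn_id_of_map_zero_of_fixed (hG : DifferentiableOn ℂ G unitDisk)
    (hmaps : MapsTo G unitDisk unitDisk) (hzero : G 0 = 0) (hb : b ∈ unitDisk) (hb₀ : b ≠ 0)
    (hfix : G b = b) : EqOn G id unitDisk := by
  have hslope : dslope G 0 b = 1 := by
    rw [dslope_of_ne _ hb₀, slope_def_field, hfix, hzero, sub_zero, div_self hb₀]
  have haffine := Complex.affine_of_mapsTo_ball_of_norm_dslope_eq_div hG (R₂ := 1)
    (hzero.symm ▸ hmaps.mono_right Metric.ball_subset_closedBall) hb
    (by rw [hslope, norm_one, div_one])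
  intro z hz
  simpa [hslope, hzero] using haffine hz

theorem eqOn_id_of_two_fixed (ha : a ∈ unitDisk) (hG : DifferentiableOn ℂ G unitDisk)
    (hmaps : MapsTo G unitDisk unitDisk) (hfix : G a = a) (hb : b ∈ unitDisk)
    (hab : b ≠ a) (hfixb : G b = b) : EqOn G id unitDisk := by
  have hb₀ : diskInvolution a b ≠ 0 := fun h₀ => hab <| by
    rw [← diskInvolution_diskInvolution ha hb, h₀, diskInvolution_zero]
  have hconj := eqOn_id_of_map_zero_of_fixed (differentiableOn_conj_diskInvolution ha hG hmaps)
    (mapsTo_conj_diskInvolution ha hmaps) (conj_diskInvolution_zero hfix)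
    (mapsTo_diskInvolution ha hb) hb₀ (by rw [conj_diskInvolution_diskInvolution ha hb, hfixb])
  intro z hz
  have hGz : diskInvolution a (G z) = diskInvolution a z := by
    rw [← conj_diskInvolution_diskInvolution ha hz]
    exact hconj (mapsTo_diskInvolution ha hz)
  rw [← diskInvolution_diskInvolution ha (hmaps hz), hGz, diskInvolution_diskInvolution ha hz, id]

theorem exists_mem_closedBall_of_norm_diskInvolution_le (ha : a ∈ unitDisk) {ρ : ℝ} (hρ : ρ < 1) :
    ∃ r < 1, ∀ z ∈ unitDisk, ‖diskInvolution a z‖ ≤ ρ → z ∈ Metric.closedBall (0 : ℂ) r := by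
  have hsub : Metric.closedBall (0 : ℂ) ρ ⊆ unitDisk := Metric.closedBall_subset_ball hρ
  rcases lt_or_ge ρ 0 with hneg | hpos
  · exact ⟨0, one_pos, fun z _ hz => absurd (hz.trans_lt hneg) (norm_nonneg _).not_gt⟩
  obtain ⟨w, hw, hmax⟩ := (isCompact_closedBall (0 : ℂ) ρ).exists_isMaxOn
    (Metric.nonempty_closedBall.2 hpos)
    ((differentiableOn_diskInvolution ha).continuousOn.mono hsub).norm
  refine ⟨‖diskInvolution a w‖, mem_ball_zero_iff.1 (mapsTo_diskInvolution ha (hsub hw)),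
    fun z hz hle => mem_closedBall_zero_iff.2 ?_⟩
  rw [← diskInvolution_diskInvolution ha hz]
  exact hmax (mem_closedBall_zero_iff.2 hle)

end DiskInvolution

section Koenigs

variable {F : ℝ → ℂ → ℂ} {f h : ℂ → ℂ} {z₀ lam z : ℂ}

theorem IsHolSemigroup.generator_ne_zero (hF : IsHolSemigroup F) (hf : IsSemigroupGenerator F f)
    (hz₀ : z₀ ∈ unitDisk) (hfz₀ : f z₀ = 0) (hd : deriv f z₀ ≠ 0) (hz : z ∈ unitDisk)
    (hne : z ≠ z₀) : f z ≠ 0 := by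
  intro hfz
  have hid : ∀ t, 0 ≤ t → EqOn (F t) id unitDisk := fun t ht =>
    eqOn_id_of_two_fixed hz₀ (hF.holomorphic t ht) (hF.mapsTo t ht)
      (hF.fixed_of_generator_eq_zero hf hz₀ hfz₀ ht) hz hne
      (hF.fixed_of_generator_eq_zero hf hz hfz ht)
  have hzero : EqOn f (fun _ => 0) unitDisk := fun w hw => by
    refine tendsto_nhds_unique (hf.tendsto w hw) (tendsto_const_nhds.congr' ?_)
    filter_upwards [self_mem_nhdsWithin] with t ht
    rw [hid t (le_of_lt ht) hw, id, sub_self, zero_div]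
  exact hd (((hzero.eventuallyEq_of_mem (isOpen_unitDisk.mem_nhds hz₀)).deriv_eq).trans
    (deriv_const z₀ 0))

theorem hasDerivAt_sub_mul_exp {P : ℂ → ℂ} {p : ℂ} (hP : HasDerivAt P p z) :
    HasDerivAt (fun w => (w - z₀) * Complex.exp (P w)) ((1 + (z - z₀) * p) * Complex.exp (P z)) z :=
  (((hasDerivAt_id z).sub_const z₀).mul hP.cexp).congr_deriv (by simp only [id]; ring)

-- With `f = (z - z₀) g` and `g = g(z₀) + (z - z₀) q`, the function `h = (z - z₀) exp P` solves
-- `h' f = f'(z₀) h` as soon as `P' = -q / g`.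
theorem exists_linearizing_function (hf : DifferentiableOn ℂ f unitDisk) (hz₀ : z₀ ∈ unitDisk)
    (hfz₀ : f z₀ = 0) (hd : deriv f z₀ ≠ 0) (hne : ∀ z ∈ unitDisk, z ≠ z₀ → f z ≠ 0) :
    ∃ h : ℂ → ℂ, DifferentiableOn ℂ h unitDisk ∧ deriv h z₀ = 1 ∧
      (∀ z, h z = 0 ↔ z = z₀) ∧ ∀ z ∈ unitDisk, deriv h z * f z = deriv f z₀ * h z := by
  have hnhds := isOpen_unitDisk.mem_nhds hz₀
  set g := dslope f z₀
  set q := dslope g z₀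
  have hg : DifferentiableOn ℂ g unitDisk := (Complex.differentiableOn_dslope hnhds).2 hf
  have hq : DifferentiableOn ℂ q unitDisk := (Complex.differentiableOn_dslope hnhds).2 hg
  have hfg : ∀ z, f z = (z - z₀) * g z := fun z => by
    rw [← smul_eq_mul, sub_smul_dslope, hfz₀, sub_zero]
  have hgq : ∀ z, (z - z₀) * q z = g z - deriv f z₀ := fun z => by
    rw [← smul_eq_mul, sub_smul_dslope, ← dslope_same f z₀]
  have hg_ne : ∀ z ∈ unitDisk, g z ≠ 0 := fun z hz hgz => by
    rcases eq_or_ne z z₀ with rfl | hzz₀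
    · exact hd ((dslope_same f z).symm.trans hgz)
    · exact hne z hz hzz₀ (by rw [hfg, hgz, mul_zero])
  obtain ⟨P, hPz₀, hP⟩ := (hq.neg.div hg hg_ne).isExactOn_ball.with_val_at z₀ 0
  have hh : ∀ z ∈ unitDisk, HasDerivAt (fun z => (z - z₀) * Complex.exp (P z))
      ((1 + (z - z₀) * (-q z / g z)) * Complex.exp (P z)) z := fun z hz =>
    hasDerivAt_sub_mul_exp (hP z hz)
  refine ⟨fun z => (z - z₀) * Complex.exp (P z),
    fun z hz => (hh z hz).differentiableAt.differentiableWithinAt, ?_, fun z => ?_, fun z hz => ?_⟩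
  · rw [(hh z₀ hz₀).deriv, hPz₀, sub_self, zero_mul, add_zero, Complex.exp_zero, one_mul]
  · rw [mul_eq_zero, or_iff_left (Complex.exp_ne_zero _), sub_eq_zero]
  · have hgz := hg_ne z hz
    rw [(hh z hz).deriv, hfg]
    field_simp
    linear_combination -(z - z₀) * hgq z

theorem IsHolSemigroup.schroeder (hF : IsHolSemigroup F) (hf : IsSemigroupGenerator F f)
    (hh : DifferentiableOn ℂ h unitDisk)
    (hode : ∀ z ∈ unitDisk, deriv h z * f z = -lam * h z) (hz : z ∈ unitDisk) {t : ℝ}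
    (ht : 0 ≤ t) : h (F t z) = Complex.exp (-lam * t) * h z := by
  have hcont : ContinuousOn (fun s : ℝ => Complex.exp (lam * s) * h (F s z)) (Icc 0 t) :=
    ContinuousOn.mul (by fun_prop) (hh.continuousOn.comp
      ((hF.continuousOn_orbit hz).mono Icc_subset_Ici_self) fun s hs => hF.mapsTo s hs.1 hz)
  have hderiv : ∀ s ∈ Ico 0 t,
      HasDerivWithinAt (fun s : ℝ => Complex.exp (lam * s) * h (F s z)) 0 (Ici s) s := by
    intro s hs
    have hmem := hF.mapsTo s hs.1 hz
    have hexp : HasDerivWithinAt (fun s : ℝ => Complex.exp (lam * s))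
        (Complex.exp (lam * s) * (lam * 1)) (Ici s) s :=
      ((hasDerivAt_id s).ofReal_comp.const_mul lam).cexp.hasDerivWithinAt
    have horbit : HasDerivWithinAt (fun s : ℝ => h (F s z)) (deriv h (F s z) * f (F s z))
        (Ici s) s :=
      (hh.hasDerivAt (isOpen_unitDisk.mem_nhds hmem)).comp_hasDerivWithinAt s
        (hF.hasDerivWithinAt_right hf hz hs.1)
    refine (hexp.mul horbit).congr_deriv ?_
    rw [hode _ hmem]
    ring
  have hconst := constant_of_has_deriv_right_zero hcont hderiv t ⟨ht, le_rfl⟩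
  rw [Complex.ofReal_zero, mul_zero, Complex.exp_zero, one_mul, hF.zero z hz] at hconst
  rw [← hconst, ← mul_assoc, ← Complex.exp_add, neg_mul, neg_add_cancel, Complex.exp_zero, one_mul]

theorem tendsto_exp_neg_mul_atTop (hlam : 0 < lam.re) :
    Tendsto (fun t : ℝ => Complex.exp (-lam * t)) atTop (𝓝 0) := by
  have hre : ∀ t : ℝ, (-lam * t).re = -lam.re * t := fun t => by
    rw [Complex.re_mul_ofReal, Complex.neg_re]
  rw [tendsto_zero_iff_norm_tendsto_zero]
  simp only [Complex.norm_exp, hre]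
  exact Real.tendsto_exp_atBot.comp (tendsto_id.const_mul_atTop_of_neg (neg_neg_of_pos hlam))

theorem IsHolSemigroup.tendsto_fixed (hF : IsHolSemigroup F) (hz₀ : z₀ ∈ unitDisk)
    (hfix : ∀ t, 0 ≤ t → F t z₀ = z₀) (hlam : 0 < lam.re) (hh : ContinuousOn h unitDisk)
    (hzero : ∀ z ∈ unitDisk, h z = 0 → z = z₀) (hz : z ∈ unitDisk)
    (hs : ∀ t : ℝ, 0 ≤ t → h (F t z) = Complex.exp (-lam * t) * h z) :
    Tendsto (fun t => F t z) atTop (𝓝 z₀) := by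
  obtain ⟨r, hr, hsub⟩ := exists_mem_closedBall_of_norm_diskInvolution_le hz₀
    (mem_ball_zero_iff.1 (mapsTo_diskInvolution hz₀ hz))
  have hlim : Tendsto (fun t => h (F t z)) atTop (𝓝 0) := by
    rw [← zero_mul (h z)]
    refine ((tendsto_exp_neg_mul_atTop hlam).mul_const (h z)).congr' ?_
    filter_upwards [eventually_ge_atTop 0] with t ht using (hs t ht).symm
  refine (isCompact_closedBall (0 : ℂ) r).tendsto_nhds_of_unique_mapClusterPt ?_ fun y hy hcl => ?_
  · filter_upwards [eventually_ge_atTop 0] with t ht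
    exact hsub _ (hF.mapsTo t ht hz) (norm_diskInvolution_le_of_fixed hz₀ (hF.holomorphic t ht)
      (hF.mapsTo t ht) (hfix t ht) hz)
  · have hyD : y ∈ unitDisk := Metric.closedBall_subset_ball hr hy
    have hhy : MapClusterPt (h y) atTop (fun t => h (F t z)) :=
      hcl.continuousAt_comp (hh.continuousAt (isOpen_unitDisk.mem_nhds hyD))
    exact hzero y hyD (eq_of_nhds_neBot (ClusterPt.mono hhy hlim))

theorem isLocallyInjective_domRestrict_of_deriv_ne_zero {U : Set ℂ} (hU : IsOpen U)
    (hh : DifferentiableOn ℂ h U) (hd : ∀ z ∈ U, deriv h z ≠ 0) :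
    IsLocallyInjective (U.domRestrict h) := by
  refine isLocallyInjective_iff_nhds.2 fun z => ?_
  have hstrict := (hh.analyticAt (hU.mem_nhds z.2)).hasStrictDerivAt
  have hinv := (hstrict.hasStrictFDerivAt_equiv (hd z z.2)).eventually_left_inverse
  exact ⟨_, continuous_subtype_val.continuousAt.eventually hinv,
    fun x hx y hy hxy => Subtype.ext (hx.symm.trans ((congrArg _ hxy).trans hy))⟩

-- Two orbits with the same `h`-image lift one and the same path along the locally injective map
-- `h`, so they coincide as soon as they meet; and they meet near `z₀`, where `h` is injective.
theorem IsHolSemigroup.injOn_of_schroeder (hF : IsHolSemigroup F)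
    (hh : DifferentiableOn ℂ h unitDisk) (hd : ∀ z ∈ unitDisk, deriv h z ≠ 0)
    (hs : ∀ t : ℝ, 0 ≤ t → ∀ z ∈ unitDisk, h (F t z) = Complex.exp (-lam * t) * h z)
    (hz₀ : z₀ ∈ unitDisk) (hlim : ∀ z ∈ unitDisk, Tendsto (fun t => F t z) atTop (𝓝 z₀)) :
    InjOn h unitDisk := by
  intro z hz w hw hzw
  have hloc := isLocallyInjective_domRestrict_of_deriv_ne_zero isOpen_unitDisk hh hd
  let orbit (x : unitDisk) (t : ℝ) : unitDisk :=
    ⟨F (max t 0) x, hF.mapsTo _ (le_max_right t 0) x.2⟩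
  have horbit : ∀ x, Continuous (orbit x) := fun x => Continuous.subtype_mk
    ((hF.continuousOn_orbit x.2).comp_continuous (by fun_prop) fun t => le_max_right t 0) _
  have himage :
      unitDisk.domRestrict h ∘ orbit ⟨z, hz⟩ = unitDisk.domRestrict h ∘ orbit ⟨w, hw⟩ := by
    ext t
    change h (F (max t 0) z) = h (F (max t 0) w)
    rw [hs _ (le_max_right t 0) z hz, hs _ (le_max_right t 0) w hw, hzw]
  have hlim' : ∀ x, Tendsto (orbit x) atTop (𝓝 ⟨z₀, hz₀⟩) := fun x => tendsto_subtype_rng.2 <|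
    (hlim x x.2).comp (tendsto_atTop_mono (fun t => le_max_left t 0) tendsto_id)
  obtain ⟨V, hV, hinj⟩ := isLocallyInjective_iff_nhds.1 hloc ⟨z₀, hz₀⟩
  obtain ⟨t, htz, htw⟩ :=
    (((hlim' ⟨z, hz⟩).eventually hV).and ((hlim' ⟨w, hw⟩).eventually hV)).exists
  have hmeet := (T2Space.isSeparatedMap _).eq_of_comp_eq hloc (horbit ⟨z, hz⟩) (horbit ⟨w, hw⟩)
    himage t (hinj htz htw (congrFun himage t))
  simpa [orbit, hF.zero z hz, hF.zero w hw] using congrFun hmeet 0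

theorem IsHolSemigroup.exists_isKoenigsFunction (hF : IsHolSemigroup F)
    (hf : IsSemigroupGenerator F f) (hz₀ : z₀ ∈ unitDisk) (hfz₀ : f z₀ = 0)
    (hlam : lam = -deriv f z₀) (hre : 0 < lam.re) : ∃ h, IsKoenigsFunction F z₀ lam h := by
  have hfd : deriv f z₀ ≠ 0 := fun h₀ => by
    rw [hlam, h₀, neg_zero, Complex.zero_re] at hre
    exact lt_irrefl _ hre
  obtain ⟨h, hh, hhd, hzero, hode⟩ := exists_linearizing_function hf.holomorphic hz₀ hfz₀ hfd
    fun z hz hne => hF.generator_ne_zero hf hz₀ hfz₀ hfd hz hne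
  have hs : ∀ t : ℝ, 0 ≤ t → ∀ z ∈ unitDisk, h (F t z) = Complex.exp (-lam * t) * h z :=
    fun t ht z hz => hF.schroeder hf hh (fun w hw => by rw [hode w hw, hlam, neg_neg]) hz ht
  have hlim : ∀ z ∈ unitDisk, Tendsto (fun t => F t z) atTop (𝓝 z₀) := fun z hz =>
    hF.tendsto_fixed hz₀ (fun t ht => hF.fixed_of_generator_eq_zero hf hz₀ hfz₀ ht) hre
      hh.continuousOn (fun w _ => (hzero w).1) hz fun t ht => hs t ht z hz
  have hd : ∀ z ∈ unitDisk, deriv h z ≠ 0 := fun z hz hdz => by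
    have hhz : deriv f z₀ * h z = 0 := by rw [← hode z hz, hdz, zero_mul]
    rw [(hzero z).1 ((mul_eq_zero.1 hhz).resolve_left hfd), hhd] at hdz
    exact one_ne_zero hdz
  exact ⟨h, hh, hF.injOn_of_schroeder hh hd hs hz₀ hlim, (hzero z₀).2 rfl, hhd, hs⟩

end Koenigs

section ParametricIntegrals

variable {X E : Type*} [TopologicalSpace X] [NormedAddCommGroup E]

theorem exists_eventually_norm_le {Y : Type*} [TopologicalSpace Y] {U : Set X} (hU : IsOpen U)
    {g : X → Y → E} (hg : ContinuousOn g.uncurry (U ×ˢ univ)) {x : X} (hx : x ∈ U) {S : Set Y}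
    (hS : IsCompact S) : ∃ K, ∀ᶠ y in 𝓝 x, ∀ s ∈ S, ‖g y s‖ ≤ K := by
  have hgx : Continuous (g x) := hg.comp_continuous (f := fun s => (x, s)) (by fun_prop)
    fun s => ⟨hx, mem_univ s⟩
  obtain ⟨K, hK⟩ := hS.exists_bound_of_continuousOn hgx.continuousOn
  refine ⟨K + 1, hS.eventually_forall_of_forall_eventually fun s hs => ?_⟩
  have hgs : ContinuousAt g.uncurry (x, s) :=
    hg.continuousAt ((hU.prod isOpen_univ).mem_nhds ⟨hx, mem_univ s⟩)
  exact (hgs.norm.eventually_lt_const ((hK s hs).trans_lt (lt_add_one K))).mono fun _ => le_of_lt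

theorem continuousOn_primitive_of_continuousOn [NormedSpace ℝ E] {U : Set X} {g : X → ℝ → E}
    (hg : ContinuousOn g.uncurry (U ×ˢ univ)) (c : ℝ) :
    ContinuousOn (fun p : X × ℝ => ∫ s in c..p.2, g p.1 s) (U ×ˢ univ) := by
  have hgU : Continuous (Function.uncurry fun (x : U) s => g x s) :=
    hg.comp_continuous (f := fun p : U × ℝ => ((p.1 : X), p.2)) (by fun_prop)
      fun p => ⟨p.1.2, mem_univ _⟩
  rw [continuousOn_iff_continuous_domRestrict]
  exact (intervalIntegral.continuous_parametric_primitive_of_continuous hgU).comp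
    (f := fun p : ↥(U ×ˢ (univ : Set ℝ)) => ((⟨p.1.1, p.2.1⟩ : U), p.1.2)) (by fun_prop)

variable [NormedSpace ℂ E] [CompleteSpace E] {U : Set ℂ} {g : ℂ → ℝ → E}

theorem continuous_deriv_of_holomorphic_param (hU : IsOpen U)
    (hg : ContinuousOn g.uncurry (U ×ˢ univ)) (hd : ∀ s, DifferentiableOn ℂ (fun z => g z s) U)
    {z : ℂ} (hz : z ∈ U) : Continuous fun s => deriv (fun w => g w s) z := by
  refine continuous_iff_continuousAt.2 fun s₀ => ?_
  have hunif : TendstoLocallyUniformlyOn (fun s w => g w s) (fun w => g w s₀) (𝓝 s₀) U := by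
    refine tendstoLocallyUniformlyOn_iff_forall_tendsto.2 fun w hw => ?_
    have hgw : ContinuousAt g.uncurry (w, s₀) :=
      hg.continuousAt ((hU.prod isOpen_univ).mem_nhds ⟨hw, mem_univ s₀⟩)
    have hfst : ContinuousAt (fun y : ℝ × ℂ => g y.2 s₀) (s₀, w) :=
      ContinuousAt.comp (g := g.uncurry) (f := fun y : ℝ × ℂ => (y.2, s₀)) hgw (by fun_prop)
    have hsnd : ContinuousAt (fun y : ℝ × ℂ => g y.2 y.1) (s₀, w) :=
      ContinuousAt.comp (g := g.uncurry) (f := Prod.swap) (x := (s₀, w)) hgw (by fun_prop)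
    refine ((hfst.prodMk hsnd).tendsto.mono_right (nhds_le_uniformity _)).mono_left ?_
    rw [nhds_prod_eq]
    exact Filter.prod_mono_right _ nhdsWithin_le_nhds
  exact (hunif.deriv (Eventually.of_forall hd) hU).tendsto_at hz

theorem differentiableOn_intervalIntegral (hU : IsOpen U)
    (hg : ContinuousOn g.uncurry (U ×ˢ univ)) (hd : ∀ s, DifferentiableOn ℂ (fun z => g z s) U)
    (a b : ℝ) : DifferentiableOn ℂ (fun z => ∫ s in a..b, g z s) U := by
  intro z₀ hz₀
  have hgz : ∀ z ∈ U, Continuous (g z) := fun z hz =>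
    hg.comp_continuous (f := fun s => (z, s)) (by fun_prop) fun s => ⟨hz, mem_univ s⟩
  obtain ⟨K, hK⟩ := exists_eventually_norm_le hU hg hz₀ (isCompact_uIcc (a := a) (b := b))
  obtain ⟨r, hr, hball⟩ := Metric.eventually_nhds_iff_ball.1 (hK.and (hU.mem_nhds hz₀))
  have hsub : ∀ z ∈ Metric.ball z₀ (r / 2), Metric.closedBall z (r / 3) ⊆ Metric.ball z₀ r :=
    fun z hz => Metric.closedBall_subset_ball' (by linarith [Metric.mem_ball.1 hz])
  have hcauchy : ∀ s ∈ uIcc a b, ∀ z ∈ Metric.ball z₀ (r / 2),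
      ‖deriv (fun w => g w s) z‖ ≤ K / (r / 3) := fun s hs z hz =>
    Complex.norm_deriv_le_of_forall_mem_sphere_norm_le (by positivity)
      (((hd s).mono fun w hw => (hball w (hsub z hz hw)).2).diffContOnCl_ball subset_rfl)
      fun w hw => (hball w (hsub z hz (Metric.sphere_subset_closedBall hw))).1 s hs
  have hderiv := intervalIntegral.hasDerivAt_integral_of_dominated_loc_of_deriv_le (𝕜 := ℂ)
    (F := g) (F' := fun z s => deriv (fun w => g w s) z) (a := a) (b := b)
    (μ := MeasureTheory.volume) (bound := fun _ => K / (r / 3))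
    (Metric.ball_mem_nhds z₀ (half_pos hr))
    ((hU.eventually_mem hz₀).mono fun z hz => (hgz z hz).aestronglyMeasurable)
    ((hgz z₀ hz₀).intervalIntegrable a b)
    (continuous_deriv_of_holomorphic_param hU hg hd hz₀).aestronglyMeasurable
    (.of_forall fun s hs => hcauchy s (uIoc_subset_uIcc hs)) intervalIntegrable_const
    (.of_forall fun s _ z hz => (hd s).hasDerivAt
      (hU.mem_nhds (hball z (Metric.ball_subset_ball (half_le_self hr.le) hz)).2))
  exact hderiv.2.differentiableAt.differentiableWithinAt

end ParametricIntegrals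

section Dyson

variable {𝒜 : Type u} [NormedRing 𝒜] [NormedAlgebra ℂ 𝒜]

/-- The `n`-th term `∫_{0 ≤ s₁ ≤ … ≤ sₙ ≤ t} a(sₙ) ⋯ a(s₁)` of the path-ordered exponential of
`a`, written as an iterated integral. -/
noncomputable def dysonTerm (a : ℝ → 𝒜) : ℕ → ℝ → 𝒜
  | 0, _ => 1
  | n + 1, t => ∫ s in (0 : ℝ)..t, a s * dysonTerm a n s

/-- The path-ordered exponential of `a`, as a Dyson series: the solution of `Y' = a Y` with
`Y 0 = 1`. -/
noncomputable def dysonSeries (a : ℝ → 𝒜) (t : ℝ) : 𝒜 := ∑' n, dysonTerm a n t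

theorem dysonSeries_zero (a : ℝ → 𝒜) : dysonSeries a 0 = 1 := by
  rw [dysonSeries, tsum_eq_single 0]
  · rfl
  · intro n hn
    obtain ⟨m, rfl⟩ := Nat.exists_eq_succ_of_ne_zero hn
    exact intervalIntegral.integral_same

section SingleCoefficient

variable {a : ℝ → 𝒜} {T K t : ℝ}

theorem continuous_dysonTerm (ha : Continuous a) (n : ℕ) : Continuous (dysonTerm a n) := by
  induction n with
  | zero => exact continuous_const
  | succ n ih =>
    exact intervalIntegral.continuous_primitive (μ := MeasureTheory.volume)
      (fun _ _ => (ha.mul ih).intervalIntegrable _ _) 0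

theorem norm_dysonTerm_le (ha : Continuous a) (hK : ∀ s ∈ Icc (-T) T, ‖a s‖ ≤ K) (n : ℕ)
    (ht : t ∈ Icc (-T) T) : ‖dysonTerm a n t‖ ≤ ‖(1 : 𝒜)‖ * ((K * |t|) ^ n / n.factorial) := by
  have hK0 : 0 ≤ K := (norm_nonneg _).trans (hK t ht)
  induction n generalizing t with
  | zero => simp [dysonTerm]
  | succ n ih =>
    have hsub : uIoc 0 t ⊆ Icc (-T) T := fun s hs => by
      have hst : |s| ≤ |t| := by simpa using abs_sub_left_of_mem_uIcc (uIoc_subset_uIcc hs)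
      exact abs_le.1 (hst.trans (abs_le.2 ht))
    have hpow : Continuous fun s : ℝ => K * (‖(1 : 𝒜)‖ * (K ^ n / n.factorial)) * |s - 0| ^ n := by
      fun_prop
    calc ‖dysonTerm a (n + 1) t‖
        ≤ ∫ s in uIoc 0 t, ‖a s * dysonTerm a n s‖ :=
          intervalIntegral.norm_integral_le_integral_norm_uIoc
      _ ≤ ∫ s in uIoc 0 t, K * (‖(1 : 𝒜)‖ * (K ^ n / n.factorial)) * |s - 0| ^ n := by
          refine MeasureTheory.setIntegral_mono_on
            (ha.mul (continuous_dysonTerm ha n)).norm.integrableOn_uIoc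
            hpow.integrableOn_uIoc measurableSet_uIoc fun s hs => ?_
          calc ‖a s * dysonTerm a n s‖
              ≤ ‖a s‖ * ‖dysonTerm a n s‖ := norm_mul_le _ _
            _ ≤ K * (‖(1 : 𝒜)‖ * ((K * |s|) ^ n / n.factorial)) :=
              mul_le_mul (hK s (hsub hs)) (ih (hsub hs)) (norm_nonneg _) hK0
            _ = K * (‖(1 : 𝒜)‖ * (K ^ n / n.factorial)) * |s - 0| ^ n := by
              rw [mul_pow, sub_zero]
              ring
      _ = ‖(1 : 𝒜)‖ * ((K * |t|) ^ (n + 1) / (n + 1).factorial) := by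
          rw [MeasureTheory.integral_const_mul, integral_pow_abs_sub_uIoc, sub_zero,
            Nat.factorial_succ]
          push_cast
          field_simp
          ring

theorem norm_dysonTerm_le_of_mem_Icc (ha : Continuous a) (hK : ∀ s ∈ Icc (-T) T, ‖a s‖ ≤ K)
    (n : ℕ) (ht : t ∈ Icc (-T) T) :
    ‖dysonTerm a n t‖ ≤ ‖(1 : 𝒜)‖ * ((K * T) ^ n / n.factorial) := by
  have hK0 : 0 ≤ K := (norm_nonneg _).trans (hK t ht)
  have htT : |t| ≤ T := abs_le.2 ht
  exact (norm_dysonTerm_le ha hK n ht).trans (by gcongr)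

theorem summable_const_mul_pow_div_factorial (c x : ℝ) :
    Summable fun n : ℕ => c * (x ^ n / n.factorial) :=
  (Real.summable_pow_div_factorial x).mul_left c

variable [CompleteSpace 𝒜]

theorem summable_dysonTerm (ha : Continuous a) (t : ℝ) : Summable fun n => dysonTerm a n t := by
  obtain ⟨K, hK⟩ := (isCompact_Icc (a := -|t|) (b := |t|)).exists_bound_of_continuousOn
    ha.continuousOn
  exact (summable_const_mul_pow_div_factorial ‖(1 : 𝒜)‖ (K * |t|)).of_norm_bounded
    fun n => norm_dysonTerm_le_of_mem_Icc ha hK n (abs_le.1 le_rfl)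

theorem hasDerivAt_dysonTerm_succ (ha : Continuous a) (n : ℕ) (t : ℝ) :
    HasDerivAt (dysonTerm a (n + 1)) (a t * dysonTerm a n t) t :=
  (ha.mul (continuous_dysonTerm ha n)).integral_hasStrictDerivAt 0 t |>.hasDerivAt

theorem hasDerivAt_dysonSeries (ha : Continuous a) (t : ℝ) :
    HasDerivAt (dysonSeries a) (a t * dysonSeries a t) t := by
  obtain ⟨T, hT⟩ : ∃ T, |t| < T := exists_gt _
  obtain ⟨K, hK⟩ := (isCompact_Icc (a := -T) (b := T)).exists_bound_of_continuousOn
    ha.continuousOn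
  have hbound : ∀ n, ∀ s ∈ Ioo (-T) T,
      ‖a s * dysonTerm a n s‖ ≤ K * (‖(1 : 𝒜)‖ * ((K * T) ^ n / n.factorial)) := fun n s hs => by
    have hs' := Ioo_subset_Icc_self hs
    exact (norm_mul_le _ _).trans (mul_le_mul (hK s hs')
      (norm_dysonTerm_le_of_mem_Icc ha hK n hs') (norm_nonneg _) ((norm_nonneg _).trans (hK s hs')))
  have htail : HasDerivAt (fun s => ∑' n, dysonTerm a (n + 1) s)
      (∑' n, a t * dysonTerm a n t) t :=
    hasDerivAt_tsum_of_isPreconnected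
      ((summable_const_mul_pow_div_factorial ‖(1 : 𝒜)‖ (K * T)).mul_left K) isOpen_Ioo
      isPreconnected_Ioo (fun n s _ => hasDerivAt_dysonTerm_succ ha n s) hbound (abs_lt.1 hT)
      ((summable_nat_add_iff 1).2 (summable_dysonTerm ha t)) (abs_lt.1 hT)
  have hsplit : dysonSeries a = fun s => 1 + ∑' n, dysonTerm a (n + 1) s :=
    funext fun s => (summable_dysonTerm ha s).tsum_eq_zero_add
  rw [(summable_dysonTerm ha t).tsum_mul_left] at htail
  rw [hsplit]
  exact (htail.const_add 1).congr_deriv (by rw [← hsplit, dysonSeries])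

end SingleCoefficient

section Parameter

theorem continuousOn_dysonTerm {X : Type*} [TopologicalSpace X] {U : Set X} {a : X → ℝ → 𝒜}
    (ha : ContinuousOn a.uncurry (U ×ˢ univ)) (n : ℕ) :
    ContinuousOn (fun p : X × ℝ => dysonTerm (a p.1) n p.2) (U ×ˢ univ) := by
  induction n with
  | zero => exact continuousOn_const
  | succ n ih =>
    exact continuousOn_primitive_of_continuousOn (g := fun x s => a x s * dysonTerm (a x) n s)
      (ha.mul ih) 0

variable [CompleteSpace 𝒜]

theorem continuousOn_dysonSeries {X : Type*} [TopologicalSpace X] {U : Set X} (hU : IsOpen U)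
    {a : X → ℝ → 𝒜} (ha : ContinuousOn a.uncurry (U ×ˢ univ)) :
    ContinuousOn (fun p : X × ℝ => dysonSeries (a p.1) p.2) (U ×ˢ univ) := by
  rintro ⟨x, t⟩ ⟨hx, -⟩
  obtain ⟨T, hT⟩ : ∃ T, |t| < T := exists_gt _
  obtain ⟨K, hK⟩ := exists_eventually_norm_le hU ha hx (isCompact_Icc (a := -T) (b := T))
  obtain ⟨V, hV, hVo, hxV⟩ := eventually_nhds_iff.1 (hK.and (hU.mem_nhds hx))
  have hVU : V ⊆ U := fun y hy => (hV y hy).2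
  have hlocal : ContinuousOn (fun p : X × ℝ => dysonSeries (a p.1) p.2) (V ×ˢ Ioo (-T) T) := by
    refine continuousOn_tsum
      (fun n => (continuousOn_dysonTerm ha n).mono (prod_mono hVU (subset_univ _)))
      (summable_const_mul_pow_div_factorial ‖(1 : 𝒜)‖ (K * T)) fun n p hp => ?_
    exact norm_dysonTerm_le_of_mem_Icc (continuousOn_univ.1 (ha.uncurry_left p.1 (hVU hp.1)))
      (hV p.1 hp.1).1 n (Ioo_subset_Icc_self hp.2)
  exact (hlocal.continuousAt
    ((hVo.prod isOpen_Ioo).mem_nhds ⟨hxV, abs_lt.1 hT⟩)).continuousWithinAt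

variable {U : Set ℂ} {a : ℂ → ℝ → 𝒜}

theorem differentiableOn_dysonTerm (hU : IsOpen U) (ha : ContinuousOn a.uncurry (U ×ˢ univ))
    (hd : ∀ s, DifferentiableOn ℂ (fun z => a z s) U) (n : ℕ) (t : ℝ) :
    DifferentiableOn ℂ (fun z => dysonTerm (a z) n t) U := by
  induction n generalizing t with
  | zero => exact differentiableOn_const 1
  | succ n ih =>
    exact differentiableOn_intervalIntegral (g := fun z s => a z s * dysonTerm (a z) n s) hU
      (ha.mul (continuousOn_dysonTerm ha n)) (fun s => (hd s).mul (ih s)) 0 t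

theorem differentiableOn_dysonSeries (hU : IsOpen U) (ha : ContinuousOn a.uncurry (U ×ˢ univ))
    (hd : ∀ s, DifferentiableOn ℂ (fun z => a z s) U) (t : ℝ) :
    DifferentiableOn ℂ (fun z => dysonSeries (a z) t) U := by
  intro z hz
  obtain ⟨K, hK⟩ := exists_eventually_norm_le hU ha hz (isCompact_Icc (a := -|t|) (b := |t|))
  obtain ⟨V, hV, hVo, hzV⟩ := eventually_nhds_iff.1 (hK.and (hU.mem_nhds hz))
  have hVU : V ⊆ U := fun w hw => (hV w hw).2
  have hlocal : DifferentiableOn ℂ (fun z => dysonSeries (a z) t) V :=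
    Complex.differentiableOn_tsum_of_summable_norm
      (summable_const_mul_pow_div_factorial ‖(1 : 𝒜)‖ (K * |t|))
      (fun n => (differentiableOn_dysonTerm hU ha hd n t).mono hVU) hVo fun n w hw =>
        norm_dysonTerm_le_of_mem_Icc (continuousOn_univ.1 (ha.uncurry_left w (hVU hw)))
          (hV w hw).1 n (abs_le.1 le_rfl)
  exact (hlocal.differentiableAt (hVo.mem_nhds hzV)).differentiableWithinAt

end Parameter

end Dyson

section Existence

variable {𝒜 : Type u} [NormedRing 𝒜] [NormedAlgebra ℂ 𝒜] {F : ℝ → ℂ → ℂ} {B : ℂ → 𝒜}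

theorem linear_ode_unique {b Y Z : ℝ → 𝒜} (hb : ContinuousOn b (Ici 0))
    (hY : ∀ t, 0 ≤ t → HasDerivWithinAt Y (b t * Y t) (Ici 0) t)
    (hZ : ∀ t, 0 ≤ t → HasDerivWithinAt Z (b t * Z t) (Ici 0) t)
    (h₀ : Y 0 = Z 0) {t : ℝ} (ht : 0 ≤ t) : Y t = Z t := by
  obtain ⟨K, hK⟩ := (isCompact_Icc (a := 0) (b := t)).exists_bound_of_continuousOn
    (hb.mono Icc_subset_Ici_self)
  have hlip : ∀ s ∈ Ico 0 t, LipschitzOnWith K.toNNReal (fun y => b s * y) univ := fun s hs =>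
    LipschitzOnWith.of_dist_le_mul fun x _ y _ => by
      rw [dist_eq_norm, dist_eq_norm, ← mul_sub]
      refine (norm_mul_le _ _).trans (mul_le_mul_of_nonneg_right ?_ (norm_nonneg _))
      exact (hK s (Ico_subset_Icc_self hs)).trans (Real.le_coe_toNNReal K)
  exact ODE_solution_unique_of_mem_Icc_right hlip
    (fun s hs => ((hY s hs.1).continuousWithinAt.mono Icc_subset_Ici_self))
    (fun s hs => (hY s hs.1).mono (Ici_subset_Ici.2 hs.1)) (fun _ _ => mem_univ _)
    (fun s hs => ((hZ s hs.1).continuousWithinAt.mono Icc_subset_Ici_self))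
    (fun s hs => (hZ s hs.1).mono (Ici_subset_Ici.2 hs.1)) (fun _ _ => mem_univ _)
    h₀ ⟨ht, le_rfl⟩

theorem SemicocycleGeneratedBy.chain {Γ : ℝ → ℂ → 𝒜} (hΓ : SemicocycleGeneratedBy F Γ B)
    (hF : IsHolSemigroup F) (hB : ContinuousOn B unitDisk) {s t : ℝ} (ht : 0 ≤ t) (hs : 0 ≤ s)
    {z : ℂ} (hz : z ∈ unitDisk) : Γ t (F s z) * Γ s z = Γ (t + s) z := by
  have hzs : F s z ∈ unitDisk := hF.mapsTo s hs hz
  have hb : ContinuousOn (fun t => B (F t (F s z))) (Ici 0) :=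
    hB.comp (hF.continuousOn_orbit hzs) fun t ht => hF.mapsTo t ht hzs
  refine linear_ode_unique (Y := fun t => Γ t (F s z) * Γ s z) (Z := fun t => Γ (t + s) z) hb
    (fun t ht => ?_) (fun t ht => ?_) ?_ ht
  · rw [← mul_assoc]
    exact ((hΓ _ hzs).2 t ht).mul_const (Γ s z)
  · rw [← hF.add t s ht hs z hz]
    have hshift : HasDerivWithinAt (fun t : ℝ => t + s) 1 (Ici 0) t :=
      ((hasDerivAt_id t).add_const s).hasDerivWithinAt
    simpa [Function.comp_def] using ((hΓ z hz).2 (t + s) (add_nonneg ht hs)).scomp t hshift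
      fun r hr => add_nonneg hr hs
  · simp only [(hΓ _ hzs).1, one_mul, zero_add]

variable [CompleteSpace 𝒜]

theorem IsHolSemigroup.exists_semicocycle (hF : IsHolSemigroup F)
    (hB : DifferentiableOn ℂ B unitDisk) :
    ∃ Γ : ℝ → ℂ → 𝒜, IsSemicocycle F Γ ∧ SemicocycleGeneratedBy F Γ B := by
  have hmem : ∀ s : ℝ, ∀ z ∈ unitDisk, F (max s 0) z ∈ unitDisk := fun s z hz =>
    hF.mapsTo _ (le_max_right s 0) hz
  have hcont : ContinuousOn (Function.uncurry fun z (s : ℝ) => B (F (max s 0) z))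
      (unitDisk ×ˢ univ) :=
    hB.continuousOn.comp (hF.continuousOn.comp (f := fun p : ℂ × ℝ => (max p.2 0, p.1))
      (by fun_prop) fun p hp => ⟨le_max_right p.2 0, hp.1⟩) fun p hp => hmem p.2 p.1 hp.1
  have hdiff : ∀ s : ℝ, DifferentiableOn ℂ (fun z => B (F (max s 0) z)) unitDisk := fun s =>
    hB.comp (hF.holomorphic _ (le_max_right s 0)) (hmem s)
  let Γ : ℝ → ℂ → 𝒜 := fun t z => dysonSeries (fun s => B (F (max s 0) z)) t
  have hgen : SemicocycleGeneratedBy F Γ B := fun z hz => by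
    refine ⟨dysonSeries_zero _, fun t ht => ?_⟩
    have hderiv := hasDerivAt_dysonSeries (continuousOn_univ.1 (hcont.uncurry_left z hz)) t
    rw [max_eq_left ht] at hderiv
    exact hderiv.hasDerivWithinAt
  refine ⟨Γ, ⟨fun t _ => differentiableOn_dysonSeries isOpen_unitDisk hcont hdiff t, ?_,
    fun t s ht hs z hz => hgen.chain hF hB.continuousOn ht hs hz, fun z hz => (hgen z hz).1⟩, hgen⟩
  exact (continuousOn_dysonSeries isOpen_unitDisk hcont).comp (f := Prod.swap)
    continuous_swap.continuousOn fun p hp => ⟨hp.2, mem_univ _⟩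

end Existence

section Taylor

theorem iteratedDeriv_pow_smul_zero {𝕜 E : Type*} [NontriviallyNormedField 𝕜]
    [NormedAddCommGroup E] [NormedSpace 𝕜 E] {g : 𝕜 → E} {m n : ℕ} (hg : ContDiffAt 𝕜 n g 0)
    (hmn : m ≤ n) : iteratedDeriv n (fun w => w ^ m • g w) 0 =
      (n.descFactorial m : 𝕜) • iteratedDeriv (n - m) g 0 := by
  have hpow : ContDiffAt 𝕜 n (fun w : 𝕜 => w ^ m) 0 := contDiffAt_id.pow m
  have hleibniz := iteratedDerivWithin_smul (mem_univ (0 : 𝕜)) uniqueDiffOn_univ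
    hpow.contDiffWithinAt hg.contDiffWithinAt
  simp only [iteratedDerivWithin_univ] at hleibniz
  rw [show (fun w => w ^ m • g w) = (fun w : 𝕜 => w ^ m) • g from rfl, hleibniz,
    Finset.sum_eq_single_of_mem m (Finset.mem_range_succ_iff.2 hmn) fun i _ him => by
      rw [iteratedDeriv_fun_pow_zero, if_neg him, Nat.cast_zero, zero_smul, smul_zero],
    iteratedDeriv_fun_pow_zero, if_pos rfl, Nat.descFactorial_eq_factorial_mul_choose]
  simp only [Nat.cast_mul, mul_comm (m.factorial : 𝕜), mul_smul, Nat.cast_smul_eq_nsmul]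

end Taylor

section Nonlinearizable

theorem exists_analyticAt_leftInvOn {h : ℂ → ℂ} {z₀ : ℂ} {U : Set ℂ} (hU : U ∈ 𝓝 z₀)
    (hh : AnalyticAt ℂ h z₀) (hd : deriv h z₀ ≠ 0) (hinj : InjOn h U) :
    ∃ g : ℂ → ℂ, AnalyticAt ℂ g (h z₀) ∧ LeftInvOn g h U ∧
      ∀ᶠ w in 𝓝 (h z₀), g w ∈ U ∧ h (g w) = w := by
  have hstrict := hh.hasStrictDerivAt.hasStrictFDerivAt_equiv hd
  have hleft : LeftInvOn (Function.invFunOn h U) h U := hinj.leftInvOn_invFunOn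
  have hlocal : Function.invFunOn h U =ᶠ[𝓝 (h z₀)] hstrict.localInverse h _ z₀ :=
    hstrict.localInverse_unique (mem_of_superset hU hleft)
  have hana : AnalyticAt ℂ (Function.invFunOn h U) (h z₀) :=
    (hh.analyticAt_localInverse hd).congr hlocal.symm
  refine ⟨Function.invFunOn h U, hana, hleft, ?_⟩
  have hmem : ∀ᶠ w in 𝓝 (h z₀), Function.invFunOn h U w ∈ U :=
    hana.continuousAt.eventually_mem (by rwa [hleft (mem_of_mem_nhds hU)])
  filter_upwards [hmem, hlocal, hstrict.eventually_right_inverse] with w hw hgw hright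
  exact ⟨hw, hgw ▸ hright⟩

variable {𝒜 : Type u} [NormedRing 𝒜] [NormedAlgebra ℂ 𝒜]

theorem mem_range_smul_sub_adOp {V : 𝒜ˣ} {A B₀ C X : 𝒜} {c μ : ℂ} (hc : c ≠ 0)
    (hC : V * B₀ = C * V) (hX : μ • X - X * B₀ + C * X = c • (V * A)) :
    A ∈ range (fun a : 𝒜 => μ • a - adOp B₀ a) := by
  have hVC : ↑V⁻¹ * C = B₀ * ↑V⁻¹ := by
    rw [Units.eq_mul_inv_iff_mul_eq, mul_assoc, ← hC, Units.inv_mul_cancel_left]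
  refine ⟨c⁻¹ • (↑V⁻¹ * X), ?_⟩
  calc μ • c⁻¹ • (↑V⁻¹ * X) - adOp B₀ (c⁻¹ • (↑V⁻¹ * X))
      = c⁻¹ • (↑V⁻¹ * (μ • X - X * B₀) + B₀ * ↑V⁻¹ * X) := by
        rw [map_smul, adOp_apply, mul_sub, mul_smul_comm, mul_assoc, mul_assoc]
        module
    _ = c⁻¹ • (↑V⁻¹ * (μ • X - X * B₀ + C * X)) := by rw [← hVC, mul_add _ _ (C * X), mul_assoc]
    _ = A := by rw [hX, mul_smul_comm, Units.inv_mul_cancel_left, inv_smul_smul₀ hc]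

theorem iteratedDeriv_mul_const_add_pow_smul {N : ℂ → 𝒜} {k : ℕ} (hN : ContDiffAt ℂ k N 0)
    (A B₀ : 𝒜) : iteratedDeriv k (fun w => N w * (B₀ + w ^ k • A)) 0 =
      iteratedDeriv k N 0 * B₀ + (k.factorial : ℂ) • (N 0 * A) := by
  have hmul : ∀ b : 𝒜, ContDiffAt ℂ k (fun w => N w * b) 0 := fun b => hN.mul contDiffAt_const
  have hpow : ContDiffAt ℂ k (fun w : ℂ => w ^ k • (N w * A)) 0 :=
    (contDiffAt_id.pow k).smul (hmul A)
  have hmul_const : iteratedDeriv k (fun w => N w * B₀) 0 = iteratedDeriv k N 0 * B₀ :=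
    iteratedDeriv_smul_const hN B₀
  simp only [mul_add, mul_smul_comm]
  rw [iteratedDeriv_fun_add (hmul B₀) hpow, hmul_const, iteratedDeriv_pow_smul_zero (hmul A) le_rfl,
    Nat.descFactorial_self, Nat.sub_self, iteratedDeriv_zero]

theorem iteratedDeriv_smul_deriv_add_const_mul {N : ℂ → 𝒜} {k : ℕ} (hk : 1 ≤ k)
    (hN : ContDiffAt ℂ (k + 1) N 0) (lam : ℂ) (C : 𝒜) :
    iteratedDeriv k (fun w => w • lam • deriv N w + C * N w) 0 =
      ((k : ℂ) * lam) • iteratedDeriv k N 0 + C * iteratedDeriv k N 0 := by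
  have hNk : ContDiffAt ℂ k N 0 := hN.of_le le_self_add
  have hN' : ContDiffAt ℂ k (fun w => lam • deriv N w) 0 := (hN.derivWithin le_rfl).const_smul lam
  have hsmulN' : ContDiffAt ℂ k (fun w : ℂ => w • lam • deriv N w) 0 := contDiffAt_id.smul hN'
  have hderiv : iteratedDeriv (k - 1) (deriv N) 0 = iteratedDeriv k N 0 := by
    rw [← iteratedDeriv_succ', Nat.sub_add_cancel hk]
  have hsmul := iteratedDeriv_pow_smul_zero hN' hk
  simp only [pow_one] at hsmul
  rw [iteratedDeriv_fun_add hsmulN' (contDiffAt_const.mul hNk), hsmul,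
    iteratedDeriv_const_mul C hNk, iteratedDeriv_fun_const_smul_field, hderiv,
    Nat.descFactorial_one, smul_smul]

variable [CompleteSpace 𝒜]

theorem mem_range_of_deriv_eq {N : ℂ → 𝒜} {A B₀ C : 𝒜} {lam : ℂ} {k : ℕ} (hk : 1 ≤ k)
    (hN : AnalyticAt ℂ N 0) (hunit : IsUnit (N 0))
    (hode : ∀ᶠ w in 𝓝 0, N w * (B₀ + w ^ k • A) = w • lam • deriv N w + C * N w) :
    A ∈ range (fun a : 𝒜 => ((k : ℂ) * lam) • a - adOp B₀ a) := by
  obtain ⟨V, hV⟩ := hunit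
  have hk₀ : k ≠ 0 := Nat.one_le_iff_ne_zero.1 hk
  have hN₀ : V * B₀ = C * V := by
    simpa [hV, hk₀] using hode.self_of_nhds
  have hNk : iteratedDeriv k N 0 * B₀ + (k.factorial : ℂ) • (V * A) =
      ((k : ℂ) * lam) • iteratedDeriv k N 0 + C * iteratedDeriv k N 0 := by
    rw [hV, ← iteratedDeriv_mul_const_add_pow_smul hN.contDiffAt,
      ← iteratedDeriv_smul_deriv_add_const_mul hk hN.contDiffAt]
    exact Filter.EventuallyEq.iteratedDeriv_eq k hode
  refine mem_range_smul_sub_adOp (Nat.cast_ne_zero.2 k.factorial_ne_zero) hN₀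
    (X := iteratedDeriv k N 0) ?_
  rw [sub_add_eq_add_sub, ← hNk, add_sub_cancel_left]

theorem hasDerivAt_exp_ofReal_smul (C : 𝒜) (t : ℝ) :
    HasDerivAt (fun t : ℝ => NormedSpace.exp ((t : ℂ) • C))
      (NormedSpace.exp ((t : ℂ) • C) * C) t :=
  ((hasDerivAt_exp_smul_const C (t : ℂ)).scomp t (hasDerivAt_id t).ofReal_comp).congr_deriv
    (one_smul ℂ _)

theorem mul_eq_of_mul_eq_exp_mul {N : ℂ → 𝒜} {γ : ℝ → 𝒜} {β C : 𝒜} {lam w : ℂ}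
    (hN : DifferentiableAt ℂ N w) (hγ : HasDerivWithinAt γ β (Ici 0) 0) (hγ₀ : γ 0 = 1)
    (heq : ∀ t : ℝ, 0 ≤ t →
      N (Complex.exp (-lam * t) * w) * γ t = NormedSpace.exp ((t : ℂ) • C) * N w) :
    N w * β = w • lam • deriv N w + C * N w := by
  have hflow : HasDerivAt (fun t : ℝ => Complex.exp (-lam * t) * w) (-lam * w) 0 := by
    simpa using (((hasDerivAt_id (0 : ℝ)).ofReal_comp.const_mul (-lam)).cexp).mul_const w
  have hflow₀ : Complex.exp (-lam * (0 : ℝ)) * w = w := by simp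
  have hNflow : HasDerivAt (fun t : ℝ => N (Complex.exp (-lam * t) * w))
      ((-lam * w) • deriv N w) 0 :=
    HasDerivAt.scomp_of_eq (0 : ℝ) hN.hasDerivAt hflow hflow₀.symm
  have hleft := hNflow.hasDerivWithinAt.mul hγ
  have hright := ((hasDerivAt_exp_ofReal_smul C 0).mul_const (N w)).hasDerivWithinAt
    (s := Ici (0 : ℝ))
  have hderiv := (uniqueDiffWithinAt_Ici (0 : ℝ)).eq_deriv _ hleft
    (hright.congr_of_mem heq self_mem_Ici)
  rw [hflow₀, hγ₀, mul_one, Complex.ofReal_zero, zero_smul, NormedSpace.exp_zero,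
    one_mul] at hderiv
  rw [← hderiv]
  module

theorem not_isLinearizable_of_notMem_range {F : ℝ → ℂ → ℂ} {h : ℂ → ℂ} {z₀ lam : ℂ}
    (hF : IsHolSemigroup F) (hz₀ : z₀ ∈ unitDisk) (hh : IsKoenigsFunction F z₀ lam h)
    {B₀ A : 𝒜} {k : ℕ} (hk : 1 ≤ k)
    (hA : A ∉ range (fun a : 𝒜 => ((k : ℂ) * lam) • a - adOp B₀ a)) {Γ : ℝ → ℂ → 𝒜}
    (hΓ : SemicocycleGeneratedBy F Γ fun z => B₀ + h z ^ k • A) : ¬ IsLinearizable F Γ := by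
  rintro ⟨M, C, hM, hunit, heq⟩
  have hnhds := isOpen_unitDisk.mem_nhds hz₀
  obtain ⟨g, hg, hgh, hhg⟩ := exists_analyticAt_leftInvOn hnhds (hh.holomorphic.analyticAt hnhds)
    (by simp [hh.deriv_fixed]) hh.injOn
  have hg₀ : g 0 = z₀ := by rw [← hh.map_fixed, hgh hz₀]
  rw [hh.map_fixed] at hg hhg
  have hN : AnalyticAt ℂ (M ∘ g) 0 := (hM.analyticAt (hg₀ ▸ hnhds)).comp hg
  refine hA (mem_range_of_deriv_eq (C := C) hk hN (hunit _ (hg₀ ▸ hz₀)) ?_)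
  filter_upwards [hN.eventually_analyticAt, hhg] with w hNw ⟨hgw, hhgw⟩
  have hcocycle : HasDerivWithinAt (fun t => Γ t (g w)) (B₀ + w ^ k • A) (Ici 0) 0 := by
    simpa only [hF.zero _ hgw, (hΓ _ hgw).1, mul_one, hhgw] using (hΓ (g w) hgw).2 0 le_rfl
  refine mul_eq_of_mul_eq_exp_mul hNw.differentiableAt hcocycle (hΓ _ hgw).1 fun t ht => ?_
  have hFt := hF.mapsTo t ht hgw
  have hgF : g (Complex.exp (-lam * t) * w) = F t (g w) := by
    rw [← hgh hFt, hh.schroeder t ht _ hgw, hhgw]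
  simp only [Function.comp_apply, hgF, heq t ht _ hgw, ← mul_assoc,
    Ring.mul_inverse_cancel _ (hunit _ hFt), one_mul]

end Nonlinearizable

section Spectrum

theorem exists_notMem_range_of_mem_spectrum {𝕜 E : Type*} [NontriviallyNormedField 𝕜]
    [CompleteSpace 𝕜] [NormedAddCommGroup E] [NormedSpace 𝕜 E] [FiniteDimensional 𝕜 E]
    {L : E →L[𝕜] E} {c : 𝕜} (hc : c ∈ spectrum 𝕜 L) : ∃ A, A ∉ range fun a => c • a - L a := by
  have := FiniteDimensional.complete 𝕜 E
  by_contra! hsurj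
  have hs : Function.Surjective (algebraMap 𝕜 (E →L[𝕜] E) c - L) := hsurj
  have hi : Function.Injective (algebraMap 𝕜 (E →L[𝕜] E) c - L) :=
    LinearMap.injective_iff_surjective (f := (algebraMap 𝕜 (E →L[𝕜] E) c - L).toLinearMap).2 hs
  exact hc (ContinuousLinearMap.isUnit_iff_bijective.2 ⟨hi, hs⟩)

theorem mem_spectrum_of_apply_eq_smul {𝕜 E : Type*} [NontriviallyNormedField 𝕜]
    [NormedAddCommGroup E] [NormedSpace 𝕜 E] {L : E →L[𝕜] E} {c : 𝕜} {x : E} (hx : x ≠ 0)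
    (hL : L x = c • x) : c ∈ spectrum 𝕜 L := by
  intro hunit
  have hbij := (Module.End.isUnit_iff _).1 (hunit.map ContinuousLinearMap.toLinearMapRingHom)
  refine hx ((injective_iff_map_eq_zero _).1 hbij.injective x ?_)
  exact sub_eq_zero.2 hL.symm

-- If `u` is a left eigenvector for `α` and `v` a right eigenvector for `β`, then `X = v uᵀ` works.
theorem exists_commutator_eigenvector {K n : Type*} [Field K] [Fintype n] [DecidableEq n]
    {B : Matrix n n K} {α β : K} (hα : α ∈ spectrum K B) (hβ : β ∈ spectrum K B) :
    ∃ X : Matrix n n K, X ≠ 0 ∧ X * B - B * X = (α - β) • X := by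
  have hdet : ∀ {γ}, γ ∈ spectrum K B → (γ • 1 - B).det = 0 := fun {γ} hγ => by
    rwa [spectrum.mem_iff, Matrix.isUnit_iff_isUnit_det, isUnit_iff_ne_zero, not_not,
      Algebra.algebraMap_eq_smul_one] at hγ
  obtain ⟨u, hu₀, hu⟩ := Matrix.exists_vecMul_eq_zero_iff.2 (hdet hα)
  obtain ⟨v, hv₀, hv⟩ := Matrix.exists_mulVec_eq_zero_iff.2 (hdet hβ)
  rw [Matrix.vecMul_sub, sub_eq_zero, Matrix.vecMul_smul, Matrix.vecMul_one] at hu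
  rw [Matrix.sub_mulVec, sub_eq_zero, Matrix.smul_mulVec, Matrix.one_mulVec] at hv
  refine ⟨Matrix.vecMulVec v u, ?_, ?_⟩
  · rw [Ne, Matrix.vecMulVec_eq_zero]
    exact not_or.2 ⟨hv₀, hu₀⟩
  · rw [Matrix.vecMulVec_mul, Matrix.mul_vecMulVec, ← hu, ← hv, Matrix.vecMulVec_smul,
      Matrix.smul_vecMulVec, sub_smul]

theorem mem_spectrum_adOp {𝒜 n : Type*} [NormedRing 𝒜] [NormedAlgebra ℂ 𝒜] [Fintype n]
    [DecidableEq n] (e : 𝒜 ≃ₐ[ℂ] Matrix n n ℂ) {B₀ : 𝒜} {c : ℂ}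
    (hc : c ∈ spectrum ℂ B₀ - spectrum ℂ B₀) : c ∈ spectrum ℂ (adOp B₀) := by
  obtain ⟨α, hα, β, hβ, rfl⟩ := Set.mem_sub.1 hc
  rw [← AlgEquiv.spectrum_eq e] at hα hβ
  obtain ⟨X, hX₀, hX⟩ := exists_commutator_eigenvector hα hβ
  refine mem_spectrum_of_apply_eq_smul ((map_ne_zero_iff e.symm e.symm.injective).2 hX₀) ?_
  apply e.injective
  rw [adOp_apply, map_sub, map_mul, map_mul, map_smul, AlgEquiv.apply_symm_apply, hX]

end Spectrum

section Generation

variable {𝒜 : Type u} [NormedRing 𝒜] [NormedAlgebra ℂ 𝒜] [CompleteSpace 𝒜]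
  {F : ℝ → ℂ → ℂ} {h : ℂ → ℂ} {z₀ lam : ℂ} {B₀ : 𝒜} {k : ℕ}

theorem IsKoenigsFunction.generatesNonlinearizable (hh : IsKoenigsFunction F z₀ lam h)
    (hF : IsHolSemigroup F) (hz₀ : z₀ ∈ unitDisk) (hk : 1 ≤ k) {A : 𝒜}
    (hA : A ∉ range (fun a : 𝒜 => ((k : ℂ) * lam) • a - adOp B₀ a)) :
    B₀ + h z₀ ^ k • A = B₀ ∧ GeneratesNonlinearizable F (fun z => B₀ + h z ^ k • A) := by
  have hB : DifferentiableOn ℂ (fun z => B₀ + h z ^ k • A) unitDisk :=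
    ((hh.holomorphic.pow k).smul_const A).const_add B₀
  refine ⟨?_, hB, hF.exists_semicocycle hB,
    fun Γ _ hΓ => not_isLinearizable_of_notMem_range hF hz₀ hh hk hA hΓ⟩
  rw [hh.map_fixed, zero_pow (Nat.one_le_iff_ne_zero.1 hk), zero_smul, add_zero]

theorem IsKoenigsFunction.exists_generatesNonlinearizable [FiniteDimensional ℂ 𝒜]
    (hh : IsKoenigsFunction F z₀ lam h) (hF : IsHolSemigroup F) (hz₀ : z₀ ∈ unitDisk)
    (hk : 1 ≤ k) (hspec : (k : ℂ) * lam ∈ spectrum ℂ (adOp B₀)) :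
    ∃ A : 𝒜, A ∉ range (fun a : 𝒜 => ((k : ℂ) * lam) • a - adOp B₀ a) ∧
      B₀ + h z₀ ^ k • A = B₀ ∧ GeneratesNonlinearizable F (fun z => B₀ + h z ^ k • A) := by
  obtain ⟨A, hA⟩ := exists_notMem_range_of_mem_spectrum hspec
  exact ⟨A, hA, hh.generatesNonlinearizable hF hz₀ hk hA⟩

end Generation

section Example

variable {F : ℝ → ℂ → ℂ} {Γ : ℝ → ℂ → Matrix (Fin 2) (Fin 2) ℂ}

theorem isHolSemigroup_exp_neg_mul (hF : ∀ t z, F t z = Complex.exp (-(t : ℂ)) * z) :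
    IsHolSemigroup F := by
  obtain rfl : F = fun (t : ℝ) z => Complex.exp (-(t : ℂ)) * z := funext₂ hF
  refine ⟨fun t _ => by fun_prop, fun t ht z hz => ?_, by fun_prop, fun t s _ _ z _ => ?_,
    fun z _ => by simp⟩
  · rw [mem_ball_zero_iff] at hz ⊢
    have hexp : ‖Complex.exp (-(t : ℂ))‖ ≤ 1 := by simpa [Complex.norm_exp] using ht
    rw [norm_mul]
    exact (mul_le_of_le_one_left (norm_nonneg z) hexp).trans_lt hz
  · rw [← mul_assoc, ← Complex.exp_add, Complex.ofReal_add, neg_add]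

theorem isKoenigsFunction_exp_neg_mul (hF : ∀ t z, F t z = Complex.exp (-(t : ℂ)) * z) :
    IsKoenigsFunction F 0 1 fun z => z :=
  ⟨by fun_prop, injOn_id _, rfl, deriv_id 0, fun t _ z _ => by simp [hF]⟩

theorem triangular_eq_sum (a b c : ℂ) : !![a, b; 0, c] =
    a • (!![1, 0; 0, 0] : Matrix (Fin 2) (Fin 2) ℂ) + b • !![0, 1; 0, 0] + c • !![0, 0; 0, 1] := by
  simp

theorem semicocycleGeneratedBy_triangular (hF : ∀ t z, F t z = Complex.exp (-(t : ℂ)) * z)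
    (hΓ : ∀ t z, Γ t z = !![Complex.exp t, z * t * Complex.exp t; 0, Complex.exp (2 * t)]) :
    SemicocycleGeneratedBy F Γ (fun z => !![1, z; 0, 2]) := by
  obtain rfl : Γ = _ := funext₂ hΓ
  refine fun z _ => ⟨by simp [Matrix.one_fin_two], fun t _ => ?_⟩
  have hid : HasDerivAt (fun t : ℝ => (t : ℂ)) 1 t := (hasDerivAt_id t).ofReal_comp
  have hd := ((hid.cexp.smul_const (!![1, 0; 0, 0] : Matrix (Fin 2) (Fin 2) ℂ)).add
    (((hid.const_mul z).mul hid.cexp).smul_const !![0, 1; 0, 0])).add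
    ((hid.const_mul 2).cexp.smul_const !![0, 0; 0, 1])
  have hexp : Complex.exp (-(t : ℂ)) * Complex.exp (2 * t) = Complex.exp t := by
    rw [← Complex.exp_add]
    ring_nf
  simp only [triangular_eq_sum (Complex.exp _)]
  refine (hd.congr_deriv ?_).hasDerivWithinAt
  rw [← triangular_eq_sum, ← triangular_eq_sum, hF, Matrix.mul_fin_two,
    mul_right_comm _ z (Complex.exp (2 * t)), hexp]
  congr! 3 <;> ring_nf

theorem isSemicocycle_triangular (hF : ∀ t z, F t z = Complex.exp (-(t : ℂ)) * z)
    (hΓ : ∀ t z, Γ t z = !![Complex.exp t, z * t * Complex.exp t; 0, Complex.exp (2 * t)]) :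
    IsSemicocycle F Γ := by
  have hgen := semicocycleGeneratedBy_triangular hF hΓ
  obtain rfl : Γ = _ := funext₂ hΓ
  have hB : Continuous fun z : ℂ => (!![1, z; 0, 2] : Matrix (Fin 2) (Fin 2) ℂ) := by
    fun_prop
  refine ⟨fun t _ => ?_, ?_, fun t s ht hs z hz => hgen.chain (isHolSemigroup_exp_neg_mul hF)
    hB.continuousOn ht hs hz, fun z hz => (hgen z hz).1⟩ <;>
  · simp only [triangular_eq_sum (Complex.exp _)]
    fun_prop

theorem triangular_notMem_range :
    (!![0, 1; 0, 0] : Matrix (Fin 2) (Fin 2) ℂ) ∉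
      range fun a => (((1 : ℕ) : ℂ) * 1) • a - adOp !![1, 0; 0, 2] a := by
  rintro ⟨a, ha⟩
  have h01 : a 0 1 - (a 0 1 * 2 - a 0 1) = 1 := by
    simpa [adOp_apply, Matrix.mul_apply, Matrix.vecMul, Matrix.vecHead] using congrFun₂ ha 0 1
  exact one_ne_zero (by linear_combination -h01)

theorem not_isLinearizable_triangular (hF : ∀ t z, F t z = Complex.exp (-(t : ℂ)) * z)
    (hΓ : SemicocycleGeneratedBy F Γ (fun z => !![1, z; 0, 2])) : ¬ IsLinearizable F Γ := by
  have : CompleteSpace (Matrix (Fin 2) (Fin 2) ℂ) := FiniteDimensional.complete ℂ _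
  refine not_isLinearizable_of_notMem_range (isHolSemigroup_exp_neg_mul hF)
    (Metric.mem_ball_self one_pos) (isKoenigsFunction_exp_neg_mul hF) le_rfl
    triangular_notMem_range ?_
  simpa using hΓ

end Example

theorem mainTheorem5_general :
    (∀ (F : ℝ → ℂ → ℂ) (f : ℂ → ℂ) (z₀ lam : ℂ), IsHolSemigroup F → IsSemigroupGenerator F f →
      z₀ ∈ unitDisk → f z₀ = 0 → lam = -deriv f z₀ → 0 < lam.re →
      ∃ h : ℂ → ℂ, IsKoenigsFunction F z₀ lam h) ∧
    (∀ (F : ℝ → ℂ → ℂ) (z₀ lam : ℂ) (h : ℂ → ℂ), IsHolSemigroup F → z₀ ∈ unitDisk →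
      IsKoenigsFunction F z₀ lam h →
      ∀ (𝒜 : Type u) [NormedRing 𝒜] [NormedAlgebra ℂ 𝒜] [CompleteSpace 𝒜] (B₀ : 𝒜) (k : ℕ),
        1 ≤ k →
        (∀ A : 𝒜, A ∉ range (fun a : 𝒜 => ((k : ℂ) * lam) • a - adOp B₀ a) →
          B₀ + h z₀ ^ k • A = B₀ ∧ GeneratesNonlinearizable F (fun z => B₀ + h z ^ k • A)) ∧
        (FiniteDimensional ℂ 𝒜 → (k : ℂ) * lam ∈ spectrum ℂ (adOp B₀) →
          ∃ A : 𝒜, A ∉ range (fun a : 𝒜 => ((k : ℂ) * lam) • a - adOp B₀ a) ∧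
            B₀ + h z₀ ^ k • A = B₀ ∧ GeneratesNonlinearizable F (fun z => B₀ + h z ^ k • A)) ∧
        (∀ n : ℕ, Nonempty (𝒜 ≃ₐ[ℂ] Matrix (Fin n) (Fin n) ℂ) →
          (k : ℂ) * lam ∈ spectrum ℂ B₀ - spectrum ℂ B₀ →
          ∃ A : 𝒜, A ∉ range (fun a : 𝒜 => ((k : ℂ) * lam) • a - adOp B₀ a) ∧
            B₀ + h z₀ ^ k • A = B₀ ∧ GeneratesNonlinearizable F (fun z => B₀ + h z ^ k • A))) ∧
    (∀ (F : ℝ → ℂ → ℂ) (Γ : ℝ → ℂ → Matrix (Fin 2) (Fin 2) ℂ),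
      (∀ t z, F t z = Complex.exp (-(t : ℂ)) * z) →
      (∀ t z, Γ t z = !![Complex.exp t, z * t * Complex.exp t; 0, Complex.exp (2 * t)]) →
      IsHolSemigroup F ∧ IsSemicocycle F Γ ∧ SemicocycleGeneratedBy F Γ (fun z => !![1, z; 0, 2]) ∧
        ¬ IsLinearizable F Γ) := by
  refine ⟨fun F f z₀ lam hF hf hz₀ hfz₀ hlam hre =>
      hF.exists_isKoenigsFunction hf hz₀ hfz₀ hlam hre,
    fun F z₀ lam h hF hz₀ hh 𝒜 _ _ _ B₀ k hk =>
      ⟨fun A hA => hh.generatesNonlinearizable hF hz₀ hk hA,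
        fun _ hspec => hh.exists_generatesNonlinearizable hF hz₀ hk hspec, ?_⟩,
    fun F Γ hF hΓ => ?_⟩
  · rintro n ⟨e⟩ hspec
    have : FiniteDimensional ℂ 𝒜 := e.symm.toLinearEquiv.finiteDimensional
    exact hh.exists_generatesNonlinearizable hF hz₀ hk (mem_spectrum_adOp e hspec)
  · have hgen := semicocycleGeneratedBy_triangular hF hΓ
    exact ⟨isHolSemigroup_exp_neg_mul hF, isSemicocycle_triangular hF hΓ, hgen,
      not_isLinearizable_triangular hF hgen⟩

theorem mainTheorem5 :
    (∀ (F : ℝ → ℂ → ℂ) (f : ℂ → ℂ) (z₀ lam : ℂ), IsHolSemigroup F → IsSemigroupGenerator F f →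
      z₀ ∈ unitDisk → f z₀ = 0 → lam = -deriv f z₀ → 0 < lam.re →
      (∃ h : ℂ → ℂ, IsKoenigsFunction F z₀ lam h) ∧
      ∀ h : ℂ → ℂ, IsKoenigsFunction F z₀ lam h →
      ∀ (𝒜 : Type u) [NormedRing 𝒜] [NormedAlgebra ℂ 𝒜] [NormOneClass 𝒜] [CompleteSpace 𝒜]
        (B₀ : 𝒜) (k : ℕ), 1 ≤ k →
        -- every perturbation direction outside the range gives a non-linearizable semicocycle
        (∀ A : 𝒜, A ∉ range (fun a : 𝒜 => ((k : ℂ) * lam) • a - adOp B₀ a) →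
          B₀ + h z₀ ^ k • A = B₀ ∧ GeneratesNonlinearizable F (fun z => B₀ + h z ^ k • A)) ∧
        -- finite-dimensional algebras: the spectral condition on `ad B₀` fails at `k`
        (FiniteDimensional ℂ 𝒜 → (k : ℂ) * lam ∈ spectrum ℂ (adOp B₀) →
          ∃ A : 𝒜, A ∉ range (fun a : 𝒜 => ((k : ℂ) * lam) • a - adOp B₀ a) ∧
            B₀ + h z₀ ^ k • A = B₀ ∧ GeneratesNonlinearizable F (fun z => B₀ + h z ^ k • A)) ∧
        -- full matrix algebras: the spectral condition on `B₀` itself fails at `k`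
        (∀ n : ℕ, Nonempty (𝒜 ≃ₐ[ℂ] Matrix (Fin n) (Fin n) ℂ) →
          (k : ℂ) * lam ∈ spectrum ℂ B₀ - spectrum ℂ B₀ →
          ∃ A : 𝒜, A ∉ range (fun a : 𝒜 => ((k : ℂ) * lam) • a - adOp B₀ a) ∧
            B₀ + h z₀ ^ k • A = B₀ ∧ GeneratesNonlinearizable F (fun z => B₀ + h z ^ k • A))) ∧
    -- the explicit `M₂(ℂ)`-valued example over `z ↦ exp(-t) z`
    (∀ (F : ℝ → ℂ → ℂ) (Γ : ℝ → ℂ → Matrix (Fin 2) (Fin 2) ℂ),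
      (∀ t z, F t z = Complex.exp (-(t : ℂ)) * z) →
      (∀ t z, Γ t z = !![Complex.exp t, z * t * Complex.exp t; 0, Complex.exp (2 * t)]) →
      IsHolSemigroup F ∧ IsSemicocycle F Γ ∧ SemicocycleGeneratedBy F Γ (fun z => !![1, z; 0, 2]) ∧
        ¬ IsLinearizable F Γ) :=
  ⟨fun F f z₀ lam hF hf hz₀ hfz₀ hlam hre =>
    ⟨mainTheorem5_general.{u}.1 F f z₀ lam hF hf hz₀ hfz₀ hlam hre,
      fun h hh 𝒜 _ _ _ _ B₀ k hk => mainTheorem5_general.2.1 F z₀ lam h hF hz₀ hh 𝒜 B₀ k hk⟩,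
    mainTheorem5_general.{u}.2.2⟩
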